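/- A monoid $M$ is called *strongly sofic* if for every finite subset $K \subset M$ there is an integer $\Delta_K \ge 1$ such that for every $\varepsilon > 0$ there exist a non-empty finite set $D$ and a map $\sigma$ from $M$ to the monoid $\mathrm{Map}(D)$ of all self-maps of $D$ (under composition) satisfying: (1) $\sigma(1_M) = \mathrm{Id}_D$; (2) $d_D(\sigma(k_1k_2), \sigma(k_1)\sigma(k_2)) \le \varepsilon$ for all $k_1, k_2 \in K$; (3) $d_D(\sigma(k_1), \sigma(k_2)) \ge 1 - \varepsilon$ for all distinct $k_1, k_2 \in K$; (4) $|\sigma(k)^{-1}(v)| \le \Delta_K$ for all $k \in K$ and $v \in D$. Here $d_D(f,g) = \frac{1}{|D|}\,|\{v \in D : f(v) \ne g(v)\}|$ is the normalized Hamming metric. For a monoid $M$ and a finite set $A$, equip $A^M$ with the product topology of the discrete topologies on the factors $A$ and with the shift action $(mx)(m') = x(m'm)$ for $m, m' \in M$, $x \in A^M$. Let $\mathrm{CA}(M,A)$ be the monoid, under composition of maps, of all cellular automata on $A^M$, i.e. of all continuous maps $\tau \colon A^M \to A^M$ with $\tau(mx) = m\tau(x)$ for all $m \in M$ and $x \in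 A^M$. **Corollary.** Let $M$ be a strongly sofic monoid and let $A$ be a finite set. Then the monoid $\mathrm{CA}(M,A)$ is directly finite, that is, for all $\tau, \tau' \in \mathrm{CA}(M,A)$, if $\tau \circ \tau' = \mathrm{Id}$ then $\tau' \circ \tau = \mathrm{Id}$. In other words, $\mathrm{CA}(M,A)$ contains no submonoid isomorphic to the bicyclic monoid $\langle p, q : pq = 1\rangle$. -/

import Mathlib

/-- The normalized Hamming distance on the set `Map(D)` of self-maps of a non-empty finite set `D`:
the proportion of points of `D` at which `f` and `g` differ. -/
noncomputable def hammingMetric {D : Type*} (f g : D → D) : ℝ :=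
  ({v : D | f v ≠ g v}.ncard : ℝ) / (Nat.card D : ℝ)

/-- A monoid `M` is strongly sofic if for every finite subset `K` there is an integer `Δ ≥ 1`,
depending only on `K`, such that for every `ε > 0` there are a non-empty finite set `D` and a map
`σ : M → Map(D)` which is unital, `ε`-almost multiplicative on `K`, `ε`-almost free on `K`, and for
which every fibre of every `σ k`, `k ∈ K`, has at most `Δ` elements. -/
def StronglySofic (M : Type*) [Monoid M] : Prop :=
  ∀ K : Finset M, ∃ Δ : ℕ, 1 ≤ Δ ∧ ∀ ε : ℝ, 0 < ε →
    ∃ (D : Type) (_ : Finite D) (_ : Nonempty D) (σ : M → D → D),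
      σ 1 = id ∧
      (∀ k₁ ∈ K, ∀ k₂ ∈ K, hammingMetric (σ (k₁ * k₂)) (σ k₁ ∘ σ k₂) ≤ ε) ∧
      (∀ k₁ ∈ K, ∀ k₂ ∈ K, k₁ ≠ k₂ → 1 - ε ≤ hammingMetric (σ k₁) (σ k₂)) ∧
      (∀ k ∈ K, ∀ v : D, (σ k ⁻¹' {v}).ncard ≤ Δ)

/-- The shift action of a monoid `M` on the configurations `x : M → A`: `m x = x ∘ R_m`, where
`R_m` is the right multiplication by `m`. -/
def configShift {M A : Type*} [Monoid M] (m : M) (x : M → A) : M → A :=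
  fun m' => x (m' * m)

theorem configShift_one {M A : Type*} [Monoid M] (x : M → A) :
    configShift (1 : M) x = x := by
  funext m'
  simp [configShift]

theorem configShift_mul {M A : Type*} [Monoid M] (m₁ m₂ : M) (x : M → A) :
    configShift (m₁ * m₂) x = configShift m₁ (configShift m₂ x) := by
  funext m'
  simp [configShift, mul_assoc]

/-- The monoid `CA(M, A)` of all cellular automata `τ : A^M → A^M`, i.e. of all self-maps of `A^M`
that are continuous for the product topology and commute with the shift. The operation
(inherited from `Function.End`) is the composition of maps and the identity element is the identity
map. When `A` carries the discrete topology, the topology on `M → A` is the prodiscrete one. -/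
def CA (M A : Type*) [Monoid M] [TopologicalSpace A] : Submonoid (Function.End (M → A)) where
  carrier := {τ : (M → A) → (M → A) |
    Continuous τ ∧ ∀ (m : M) (x : M → A), τ (configShift m x) = configShift m (τ x)}
  mul_mem' := by
    rintro τ₁ τ₂ ⟨h₁, e₁⟩ ⟨h₂, e₂⟩
    refine ⟨h₁.comp h₂, fun m x => ?_⟩
    change τ₁ (τ₂ (configShift m x)) = configShift m (τ₁ (τ₂ x))
    rw [e₂, e₁]
  one_mem' := ⟨continuous_id, fun _ _ => rfl⟩

/-- The two generators of the bicyclic monoid. -/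
inductive BicyclicGen : Type
  | p : BicyclicGen
  | q : BicyclicGen

/-- The single defining relation `p q = 1` of the bicyclic monoid. -/
inductive BicyclicRel : FreeMonoid BicyclicGen → FreeMonoid BicyclicGen → Prop
  | pq : BicyclicRel (FreeMonoid.of BicyclicGen.p * FreeMonoid.of BicyclicGen.q) 1

/-- The bicyclic monoid, given by the presentation `⟨p, q : p q = 1⟩`. -/
abbrev BicyclicMonoid : Type := PresentedMonoid BicyclicRel

/-! Local rules `g`, `g'` of two automata act on `D → A`, each `v` in the finite sofic model `D`
reading `y` along `m ↦ σ m v`. If `τ ∘ τ' = id`, the model of `g` undoes that of `g'` off a small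
set `B`, so the image of the latter has at least `|A| ^ (|D| - |B|)` elements
(`card_pow_le_card_image_mul`). If `τ' (τ z)` and `z` differ at `1`, no image element shows the
pattern `z` on the window `σ(K) v` of a good `v`. Avoiding a pattern on many disjoint windows
shrinks the count exponentially (`card_avoiding_mul_le`), which contradicts the lower bound. The
fibre bound `Δ` is used twice: few points are sent into `B`, and each window meets boundedly many
others, so disjoint windows are a fixed proportion of `D`. -/

/-- A continuous function on a product of finite discrete spaces, with values in a discrete space,
depends only on finitely many coordinates. -/
theorem exists_finset_dependsOn_of_continuous {M A B : Type*} [Finite A] [TopologicalSpace A]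
    [DiscreteTopology A] [TopologicalSpace B] [DiscreteTopology B] {g : (M → A) → B}
    (hg : Continuous g) :
    ∃ F : Finset M, ∀ x y : M → A, (∀ m ∈ F, x m = y m) → g x = g y := by
  classical
  have hloc : ∀ x : M → A, ∃ I : Finset M, ∀ y : M → A, (∀ m ∈ I, y m = x m) → g y = g x := by
    intro x
    have ho : IsOpen (g ⁻¹' {g x}) := (isOpen_discrete _).preimage hg
    obtain ⟨I, u, hu, hsub⟩ := isOpen_pi_iff.1 ho x rfl
    refine ⟨I, fun y hy => hsub fun m hm => ?_⟩
    rw [hy m hm]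
    exact (hu m hm).2
  choose I hI using hloc
  have hopen : ∀ x : M → A, IsOpen (Set.pi (I x : Set M) fun m => {x m}) := fun x =>
    isOpen_set_pi (I x).finite_toSet fun _ _ => isOpen_discrete _
  -- `A` is finite, so `M → A` is compact and finitely many cylinders suffice.
  obtain ⟨t, ht⟩ := isCompact_univ.elim_finite_subcover
    (fun x : M → A => Set.pi (I x : Set M) fun m => {x m}) hopen
    (fun x _ => Set.mem_iUnion.2 ⟨x, fun m _ => rfl⟩)
  refine ⟨t.biUnion I, fun x y hxy => ?_⟩
  obtain ⟨z, hz, hxz⟩ := Set.mem_iUnion₂.1 (ht (Set.mem_univ x))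
  have hx : ∀ m ∈ I z, x m = z m := fun m hm => hxz m hm
  rw [hI z x hx, hI z y fun m hm => ?_]
  rw [← hxy m (Finset.mem_biUnion.2 ⟨z, hz, hm⟩), hx m hm]

/-- Strong soficity with the Hamming distances replaced by bounds on numbers of points. -/
theorem StronglySofic.exists_card_le {M : Type*} [Monoid M] (hM : StronglySofic M)
    (K : Finset M) :
    ∃ Δ : ℕ, 1 ≤ Δ ∧ ∀ L : ℕ, 1 ≤ L →
      ∃ (D : Type) (_ : Fintype D) (_ : Nonempty D) (σ : M → D → D) (e : ℕ),
        L * e ≤ Fintype.card D ∧ σ 1 = id ∧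
        (∀ k₁ ∈ K, ∀ k₂ ∈ K, {v | σ (k₁ * k₂) v ≠ σ k₁ (σ k₂ v)}.ncard ≤ e) ∧
        (∀ k₁ ∈ K, ∀ k₂ ∈ K, k₁ ≠ k₂ → {v | σ k₁ v = σ k₂ v}.ncard ≤ e) ∧
        (∀ k ∈ K, ∀ v : D, (σ k ⁻¹' {v}).ncard ≤ Δ) := by
  obtain ⟨Δ, hΔ, h⟩ := hM K
  refine ⟨Δ, hΔ, fun L hL => ?_⟩
  have hL0 : (0 : ℝ) < L := by exact_mod_cast hL
  obtain ⟨D, hD, hne, σ, h1, hmul, hinj, hfib⟩ := h (1 / L) (by positivity)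
  let _ := Fintype.ofFinite D
  have hD0 : (0 : ℝ) < Nat.card D := by exact_mod_cast Nat.card_pos
  -- With `ε = 1 / L` the counts are integers at most `|D| / L`, hence at most its floor.
  refine ⟨D, inferInstance, hne, σ, Nat.card D / L, ?_, h1, ?_, ?_, hfib⟩
  · rw [← Nat.card_eq_fintype_card]
    exact Nat.mul_div_le _ _
  · intro k₁ hk₁ k₂ hk₂
    have := hmul k₁ hk₁ k₂ hk₂
    rw [hammingMetric, div_le_div_iff₀ hD0 hL0, one_mul] at this
    rw [Nat.le_div_iff_mul_le hL]
    exact_mod_cast this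
  · intro k₁ hk₁ k₂ hk₂ hne'
    have := hinj k₁ hk₁ k₂ hk₂ hne'
    have hc := Set.ncard_add_ncard_compl {v : D | σ k₁ v = σ k₂ v}
    have hc' : ({v : D | σ k₁ v = σ k₂ v}.ncard : ℝ) + ({v : D | σ k₁ v ≠ σ k₂ v}.ncard : ℝ)
        = Nat.card D := by exact_mod_cast hc
    rw [hammingMetric, le_div_iff₀ hD0, sub_mul, one_mul] at this
    rw [Nat.le_div_iff_mul_le hL]
    have h2 : ({v : D | σ k₁ v = σ k₂ v}.ncard : ℝ) ≤ 1 / L * Nat.card D := by linarith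
    rw [one_div_mul_eq_div, le_div_iff₀ hL0] at h2
    exact_mod_cast h2

/-! ### Counting on finite sets -/

/-- From a finite family of sets, each meeting at most `N` members, one can extract pairwise
disjoint members whose number is at least the size of the family divided by `N`. -/
theorem exists_pairwiseDisjoint_card_le {ι D : Type*} [DecidableEq ι] [DecidableEq D]
    (W : ι → Finset D) {N : ℕ} (V₀ : Finset ι) (hW : ∀ v ∈ V₀, (W v).Nonempty)
    (hN : ∀ w ∈ V₀, (V₀.filter fun v => ¬ Disjoint (W v) (W w)).card ≤ N) :
    ∃ V ⊆ V₀, (V : Set ι).PairwiseDisjoint W ∧ V₀.card ≤ V.card * N := by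
  classical
  obtain ⟨V, hV, hmax⟩ := Finset.exists_max_image
    (V₀.powerset.filter fun V : Finset ι => (V : Set ι).PairwiseDisjoint W) Finset.card
    ⟨∅, by simp⟩
  rw [Finset.mem_filter, Finset.mem_powerset] at hV
  refine ⟨V, hV.1, hV.2, ?_⟩
  have hcov : V₀ ⊆ V.biUnion fun w => V₀.filter fun v => ¬ Disjoint (W v) (W w) := by
    intro v hv
    by_contra hnot
    have hdisj : ∀ w ∈ V, Disjoint (W v) (W w) := by
      intro w hw
      by_contra hd
      exact hnot (Finset.mem_biUnion.2 ⟨w, hw, Finset.mem_filter.2 ⟨hv, hd⟩⟩)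
    have hvV : v ∉ V := fun h => (hW v hv).ne_empty (disjoint_self.1 (hdisj v h))
    have := hmax (insert v V) (by
      rw [Finset.mem_filter, Finset.mem_powerset, Finset.coe_insert]
      exact ⟨Finset.insert_subset hv hV.1, hV.2.insert fun w hw _ => hdisj w hw⟩)
    rw [Finset.card_insert_of_notMem hvV] at this
    omega
  exact (Finset.card_le_card hcov).trans
    (Finset.card_biUnion_le_card_mul _ _ _ fun w hw => hN w (hV.1 hw))

/-- The number of configurations avoiding a prescribed pattern on each of several disjoint
windows decays exponentially with the number of windows. -/
theorem card_avoiding_mul_le {ι D A : Type*} [DecidableEq ι] [Fintype D] [DecidableEq D]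
    [Fintype A] [DecidableEq A] [Nonempty A] (W : ι → Finset D) (q : ι → D → A) {n : ℕ}
    (V : Finset ι) (hdisj : (V : Set ι).PairwiseDisjoint W) (hn : ∀ v ∈ V, (W v).card ≤ n) :
    (Finset.univ.filter fun y : D → A => ∀ v ∈ V, ∃ d ∈ W v, y d ≠ q v d).card *
        (Fintype.card A ^ n) ^ V.card ≤
      (Fintype.card A ^ n - 1) ^ V.card * Fintype.card A ^ Fintype.card D := by
  induction V using Finset.induction_on with
  | empty => simp
  | insert v V hv ih =>
    have ih := ih (hdisj.subset (by simp)) fun w hw => hn w (Finset.mem_insert_of_mem hw)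
    set Y := Finset.univ.filter fun y : D → A => ∀ w ∈ V, ∃ d ∈ W w, y d ≠ q w d with hY
    set Y' := Finset.univ.filter
      fun y : D → A => ∀ w ∈ insert v V, ∃ d ∈ W w, y d ≠ q w d with hY'
    have hsub : Y' ⊆ Y := fun y hy => by
      simp only [hY, hY', Finset.mem_filter, Finset.mem_univ, true_and] at hy ⊢
      exact fun w hw => hy w (Finset.mem_insert_of_mem hw)
    -- Overwriting the window of `v` by its forbidden pattern spoils no other window, and each fibre
    -- has at most `p = |A| ^ n` points. Thus `|Y| ≤ p (|Y| - |Y'|)`, i.e. `p |Y'| ≤ (p - 1) |Y|`.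
    let f : (D → A) → D → A := fun y d => if d ∈ W v then q v d else y d
    have hmaps : ∀ y ∈ Y, f y ∈ Y \ Y' := by
      intro y hy
      simp only [hY, hY', Finset.mem_sdiff, Finset.mem_filter, Finset.mem_univ, true_and] at hy ⊢
      refine ⟨fun w hw => ?_, fun h => ?_⟩
      · obtain ⟨d, hd, hne⟩ := hy w hw
        have hvw : Disjoint (W v) (W w) := hdisj (by simp) (by simp [hw])
          (fun h => hv (h ▸ hw))
        have hdv : d ∉ W v := fun h => Finset.disjoint_left.1 hvw h hd
        exact ⟨d, hd, by simpa only [f, if_neg hdv] using hne⟩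
      · obtain ⟨d, hd, hne⟩ := h v (Finset.mem_insert_self _ _)
        exact hne (by simp only [f, if_pos hd])
    have hfib : ∀ u ∈ Y \ Y', (Y.filter fun y => f y = u).card ≤ Fintype.card A ^ n := by
      intro u _
      calc (Y.filter fun y => f y = u).card
          ≤ (Finset.univ : Finset (W v → A)).card := by
            refine Finset.card_le_card_of_injOn (fun y d => y d) (fun _ _ => by simp) ?_
            intro y₁ h₁ y₂ h₂ h
            have h₁ := (Finset.mem_filter.1 h₁).2
            have h₂ := (Finset.mem_filter.1 h₂).2
            funext d
            by_cases hd : d ∈ W v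
            · exact congrFun h ⟨d, hd⟩
            · have := congrFun (h₁.trans h₂.symm) d
              simpa only [f, if_neg hd] using this
        _ = Fintype.card A ^ (W v).card := by simp
        _ ≤ Fintype.card A ^ n :=
            Nat.pow_le_pow_right Fintype.card_pos (hn v (Finset.mem_insert_self _ _))
    have hcard : Y.card ≤ Fintype.card A ^ n * (Y \ Y').card :=
      Finset.card_le_mul_card_image_of_maps_to hmaps _ hfib
    rw [Finset.card_sdiff_of_subset hsub] at hcard
    have hle := Finset.card_le_card hsub
    have hp : 1 ≤ Fintype.card A ^ n := Nat.one_le_pow _ _ Fintype.card_pos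
    set p := Fintype.card A ^ n
    have hstep : Y'.card * p ≤ (p - 1) * Y.card := by
      obtain ⟨c, hc⟩ := Nat.exists_eq_add_of_le hle
      obtain ⟨r, hr⟩ := Nat.exists_eq_add_of_le hp
      rw [hc, Nat.add_sub_cancel_left] at hcard
      rw [hc, hr, Nat.add_sub_cancel_left]
      rw [hr] at hcard
      nlinarith
    rw [Finset.card_insert_of_notMem hv, pow_succ, pow_succ]
    calc Y'.card * (p ^ V.card * p) = (Y'.card * p) * p ^ V.card := by ring
      _ ≤ ((p - 1) * Y.card) * p ^ V.card := Nat.mul_le_mul_right _ hstep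
      _ = (p - 1) * (Y.card * p ^ V.card) := by ring
      _ ≤ (p - 1) * ((p - 1) ^ V.card * Fintype.card A ^ Fintype.card D) :=
          Nat.mul_le_mul_left _ ih
      _ = _ := by ring

/-- If a map on configurations has an inverse on the left that is correct off `B`, then its range
is large. -/
theorem card_pow_le_card_image_mul {D A : Type*} [Fintype D] [DecidableEq D] [Fintype A]
    [DecidableEq A] (f h : (D → A) → D → A) (B : Finset D)
    (hB : ∀ y, ∀ v ∉ B, h (f y) v = y v) :
    Fintype.card A ^ Fintype.card D ≤
      (Finset.univ.image f).card * Fintype.card A ^ B.card := by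
  have := Finset.card_le_card_of_injOn (s := (Finset.univ : Finset (D → A)))
    (t := Finset.univ.image f ×ˢ (Finset.univ : Finset (B → A)))
    (fun y => (f y, fun d => y d)) (fun y _ => by simp) (by
      intro y₁ _ y₂ _ heq
      obtain ⟨h₁, h₂⟩ := Prod.mk.inj heq
      funext d
      by_cases hd : d ∈ B
      · exact congrFun h₂ ⟨d, hd⟩
      · rw [← hB y₁ d hd, ← hB y₂ d hd, h₁])
  simpa using this

/-- `T` is the number of windows whose loss outweighs the factor `a` conceded at one bad point. -/
theorem exists_pow_pred_mul_lt_pow (a p : ℕ) (hp : 1 ≤ p) :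
    ∃ T : ℕ, (p - 1) ^ T * a < p ^ T := by
  obtain ⟨r, rfl⟩ := Nat.exists_eq_add_of_le' hp
  rw [Nat.add_sub_cancel]
  rcases Nat.eq_zero_or_pos r with rfl | hr
  · exact ⟨1, by simp⟩
  have hr' : (0 : ℝ) < r := by exact_mod_cast hr
  obtain ⟨T, hT⟩ := pow_unbounded_of_one_lt (a : ℝ) (show (1 : ℝ) < (r + 1) / r by
    rw [lt_div_iff₀ hr']; linarith)
  refine ⟨T, ?_⟩
  rw [div_pow, lt_div_iff₀ (by positivity)] at hT
  rw [mul_comm]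
  exact_mod_cast hT

theorem pow_pred_mul_pow_lt_pow {a p T B V : ℕ} (hp : 1 ≤ p) (hT : (p - 1) ^ T * a < p ^ T)
    (hB : T * B ≤ V) (hV : 0 < V) : (p - 1) ^ V * a ^ B < p ^ V := by
  obtain ⟨r, rfl⟩ := Nat.exists_eq_add_of_le hB
  rcases Nat.eq_zero_or_pos B with rfl | hB0
  · rw [pow_zero, mul_one]
    exact Nat.pow_lt_pow_left (by omega) (by omega)
  · calc (p - 1) ^ (T * B + r) * a ^ B = ((p - 1) ^ T * a) ^ B * (p - 1) ^ r := by
          rw [pow_add, pow_mul, mul_pow]; ring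
      _ ≤ ((p - 1) ^ T * a) ^ B * p ^ r :=
          Nat.mul_le_mul_left _ (Nat.pow_le_pow_left (by omega) _)
      _ < (p ^ T) ^ B * p ^ r :=
          Nat.mul_lt_mul_of_pos_right (Nat.pow_lt_pow_left hT hB0.ne') (by positivity)
      _ = p ^ (T * B + r) := by rw [pow_add, pow_mul]

/-- A map between finite sets all of whose fibres have at most `Δ` points pulls a set back to one
at most `Δ` times as large. -/
theorem card_filter_mem_le {D : Type*} [Fintype D] [DecidableEq D] (f : D → D) (B : Finset D)
    {Δ : ℕ} (hf : ∀ v, (f ⁻¹' {v}).ncard ≤ Δ) :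
    (Finset.univ.filter fun v => f v ∈ B).card ≤ B.card * Δ := by
  rw [mul_comm]
  refine Finset.card_le_mul_card_image_of_maps_to (f := f) (by simp) _ fun b _ => ?_
  refine le_trans ?_ (hf b)
  rw [← Set.ncard_coe_finset]
  exact Set.ncard_le_ncard (fun v hv => (Finset.mem_filter.1 hv).2) (Set.toFinite _)

/-! ### Models of local rules on sofic approximations -/

/-- The local rule `g` of a cellular automaton, transported to the configurations on `D` by means
of `σ : M → Map(D)`. -/
def localModel {M A D : Type*} (g : (M → A) → A) (σ : M → D → D) (y : D → A) : D → A :=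
  fun v => g fun m => y (σ m v)

/-- Where `σ` is multiplicative, moving from `v` to `σ t v` shifts the pulled-back configuration `k
↦ y (σ k v)` by `t`, so the rules compose as over `M`. -/
theorem localModel_localModel {M A D : Type*} [Monoid M] {g g' : (M → A) → A} {σ : M → D → D}
    {F : Set M} (hg : ∀ x y : M → A, (∀ m ∈ F, x m = y m) → g x = g y)
    (hg' : ∀ x y : M → A, (∀ m ∈ F, x m = y m) → g' x = g' y) {v : D}
    (hv : ∀ s ∈ F, ∀ t ∈ F, σ (s * t) v = σ s (σ t v)) (y : D → A) :
    localModel g σ (localModel g' σ y) v =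
      g fun m => g' (configShift m fun k => y (σ k v)) :=
  hg _ _ fun t ht => hg' _ _ fun s hs => by
    change y (σ s (σ t v)) = y (σ (s * t) v)
    rw [hv s hs t ht]

/-- The combinatorial core: a pair of local rules over a strongly sofic monoid that are inverse in
one order are inverse in the other order. -/
theorem StronglySofic.localRule_comp_eq {M A : Type*} [Monoid M] (hM : StronglySofic M)
    [Finite A] {g g' : (M → A) → A} {F : Finset M} (h1F : 1 ∈ F)
    (hg : ∀ x y : M → A, (∀ m ∈ F, x m = y m) → g x = g y)
    (hg' : ∀ x y : M → A, (∀ m ∈ F, x m = y m) → g' x = g' y)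
    (hinv : ∀ x : M → A, g (fun m => g' (configShift m x)) = x 1) (z : M → A) :
    g' (fun m => g (configShift m z)) = z 1 := by
  classical
  by_contra hz
  have : Nonempty A := ⟨z 1⟩
  let _ := Fintype.ofFinite A
  set K : Finset M := (F ×ˢ F).image fun p => p.1 * p.2 with hK
  have hmulK : ∀ s ∈ F, ∀ t ∈ F, s * t ∈ K := fun s hs t ht =>
    Finset.mem_image.2 ⟨(s, t), Finset.mem_product.2 ⟨hs, ht⟩, rfl⟩
  have hFK : F ⊆ K := fun s hs => by simpa using hmulK s hs 1 h1F
  have h1K : 1 ∈ K := hFK h1F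
  set n := K.card with hn
  have hn0 : 1 ≤ n := Finset.card_pos.2 ⟨1, h1K⟩
  set a := Fintype.card A
  have ha : 0 < a := Fintype.card_pos
  have hp : 1 ≤ a ^ n := Nat.one_le_pow _ _ ha
  obtain ⟨T, hT⟩ := exists_pow_pred_mul_lt_pow a (a ^ n) hp
  obtain ⟨Δ, hΔ, hsof⟩ := hM.exists_card_le K
  obtain ⟨D, _, _, σ, e, he, h1, hmul, hinj, hfib⟩ :=
    -- The first two terms pay for discarding `B₁` and `B₂`; the third leaves enough points for `T *
    -- |B|` disjoint windows, each costing `n * n * Δ`; the `1` leaves a point over when `e > 0`.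
    hsof (n * (n * n * Δ) + n * n + n * n * Δ * (T * (n * n)) + 1) (by omega)
  -- the points where `σ` is not multiplicative on `F`
  set B : Finset D := Finset.univ.filter fun v =>
    ¬ ∀ s ∈ F, ∀ t ∈ F, σ (s * t) v = σ s (σ t v) with hBdef
  have hBgood : ∀ v ∉ B, ∀ s ∈ F, ∀ t ∈ F, σ (s * t) v = σ s (σ t v) := by
    intro v hv
    simpa only [hBdef, Finset.mem_filter, Finset.mem_univ, true_and, not_not] using hv
  have hBcard : B.card ≤ n * n * e := by
    have hsub : B ⊆ (K ×ˢ K).biUnion fun p =>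
        {v | σ (p.1 * p.2) v ≠ σ p.1 (σ p.2 v)}.toFinite.toFinset := by
      intro v hv
      simp only [hBdef, Finset.mem_filter, Finset.mem_univ, true_and] at hv
      push Not at hv
      obtain ⟨s, hs, t, ht, hne⟩ := hv
      exact Finset.mem_biUnion.2 ⟨(s, t), Finset.mem_product.2 ⟨hFK hs, hFK ht⟩, by simpa using hne⟩
    refine (Finset.card_le_card hsub).trans ?_
    rw [← Finset.card_product]
    refine Finset.card_biUnion_le_card_mul _ _ _ fun p hp => ?_
    rw [← Set.ncard_eq_toFinset_card]
    exact hmul _ (Finset.mem_product.1 hp).1 _ (Finset.mem_product.1 hp).2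
  set B₁ : Finset D := Finset.univ.filter fun v => ∃ t ∈ F, σ t v ∈ B with hB₁def
  have hB₁card : B₁.card ≤ n * (B.card * Δ) := by
    have hsub : B₁ ⊆ K.biUnion fun t => Finset.univ.filter fun v => σ t v ∈ B := by
      intro v hv
      obtain ⟨t, ht, htv⟩ := (Finset.mem_filter.1 hv).2
      exact Finset.mem_biUnion.2 ⟨t, hFK ht, by simpa using htv⟩
    exact (Finset.card_le_card hsub).trans <| Finset.card_biUnion_le_card_mul _ _ _ fun t ht =>
      card_filter_mem_le _ _ (hfib t ht)
  set B₂ : Finset D := Finset.univ.filter fun v =>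
    ∃ k ∈ K, ∃ l ∈ K, k ≠ l ∧ σ k v = σ l v with hB₂def
  have hB₂card : B₂.card ≤ n * n * e := by
    have hsub : B₂ ⊆ ((K ×ˢ K).filter fun p => p.1 ≠ p.2).biUnion fun p =>
        {v | σ p.1 v = σ p.2 v}.toFinite.toFinset := by
      intro v hv
      obtain ⟨k, hk, l, hl, hne, heq⟩ := (Finset.mem_filter.1 hv).2
      exact Finset.mem_biUnion.2 ⟨(k, l), Finset.mem_filter.2
        ⟨Finset.mem_product.2 ⟨hk, hl⟩, hne⟩, by simpa using heq⟩
    refine (Finset.card_le_card hsub).trans ?_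
    refine (Finset.card_biUnion_le_card_mul _ _ e fun p hp => ?_).trans
      (Nat.mul_le_mul_right _ ((Finset.card_filter_le _ _).trans
        (Finset.card_product _ _).le))
    obtain ⟨hp, hne⟩ := Finset.mem_filter.1 hp
    rw [← Set.ncard_eq_toFinset_card]
    exact hinj _ (Finset.mem_product.1 hp).1 _ (Finset.mem_product.1 hp).2 hne
  set V₀ : Finset D := (B₁ ∪ B₂)ᶜ with hV₀
  have hV₀card : Fintype.card D ≤ V₀.card + (n * (n * n * e * Δ) + n * n * e) := by
    have h₁ := Finset.card_add_card_compl (B₁ ∪ B₂)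
    rw [← hV₀] at h₁
    have h₂ := Finset.card_union_le B₁ B₂
    have h₃ : n * (B.card * Δ) ≤ n * (n * n * e * Δ) := by gcongr
    omega
  have hV₀inj : ∀ v ∈ V₀, Set.InjOn (fun k => σ k v) K := by
    intro v hv k hk l hl heq
    by_contra hne
    exact (Finset.mem_compl.1 hv) (Finset.mem_union_right _
      (Finset.mem_filter.2 ⟨Finset.mem_univ _, k, hk, l, hl, hne, heq⟩))
  have hV₀good : ∀ v ∈ V₀, ∀ t ∈ F, σ t v ∉ B := by
    intro v hv t ht hB
    exact (Finset.mem_compl.1 hv) (Finset.mem_union_left _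
      (Finset.mem_filter.2 ⟨Finset.mem_univ _, t, ht, hB⟩))
  let W : D → Finset D := fun v => K.image fun k => σ k v
  obtain ⟨V, hVV₀, hVdisj, hVcard⟩ := exists_pairwiseDisjoint_card_le W (N := n * n * Δ) V₀
    (fun v _ => ⟨σ 1 v, Finset.mem_image_of_mem _ h1K⟩) (by
      intro w _
      have hsub : (V₀.filter fun v => ¬ Disjoint (W v) (W w)) ⊆
          K.biUnion fun k => Finset.univ.filter fun v => σ k v ∈ W w := by
        intro v hv
        obtain ⟨d, hd, hdw⟩ := Finset.not_disjoint_iff.1 (Finset.mem_filter.1 hv).2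
        obtain ⟨k, hk, rfl⟩ := Finset.mem_image.1 hd
        exact Finset.mem_biUnion.2 ⟨k, hk, by simpa using hdw⟩
      refine (Finset.card_le_card hsub).trans ?_
      rw [mul_assoc]
      exact Finset.card_biUnion_le_card_mul _ _ _ fun k hk =>
        (card_filter_mem_le _ _ (hfib k hk)).trans
          (Nat.mul_le_mul_right _ Finset.card_image_le))
  have hDpos : 0 < Fintype.card D := Fintype.card_pos
  have hTB : T * B.card ≤ V.card := by
    have h₁ : n * n * Δ * (T * (n * n * e)) ≤ n * n * Δ * V.card := by nlinarith
    exact (Nat.mul_le_mul_left _ hBcard).trans (Nat.le_of_mul_le_mul_left h₁ (by positivity))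
  have hVpos : 0 < V.card := by
    -- For `e = 0` the bound `he` is vacuous, but nothing is discarded and `D` is non-empty.
    rcases Nat.eq_zero_or_pos e with rfl | he0
    · by_contra h0
      obtain h0 : V.card = 0 := by omega
      rw [h0] at hVcard
      simp at hV₀card hVcard
      simp [hVcard] at hV₀card
    · by_contra h0
      obtain h0 : V.card = 0 := by omega
      rw [h0] at hVcard
      nlinarith [Nat.zero_le (n * n * Δ * (T * (n * n)) * e)]
  -- The pattern `z`, carried to the window of `v` by the injection `k ↦ σ k v`; values off the
  -- window are irrelevant.
  let q : D → D → A := fun v d => z (Function.invFunOn (fun k => σ k v) K d)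
  have hq : ∀ v ∈ V₀, ∀ k ∈ K, q v (σ k v) = z k := fun v hv k hk =>
    congrArg z ((hV₀inj v hv).leftInvOn_invFunOn hk)
  have hleft : ∀ y, ∀ v ∉ B, localModel g σ (localModel g' σ y) v = y v := by
    intro y v hv
    rw [localModel_localModel (F := (F : Set M)) hg hg' (hBgood v hv), hinv, h1]
    rfl
  have hlow := card_pow_le_card_image_mul (localModel g' σ) (localModel g σ) B hleft
  have havoid : Finset.univ.image (localModel (A := A) g' σ) ⊆
      Finset.univ.filter fun y : D → A => ∀ v ∈ V, ∃ d ∈ W v, y d ≠ q v d := by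
    intro y hy
    obtain ⟨w, -, rfl⟩ := Finset.mem_image.1 hy
    refine Finset.mem_filter.2 ⟨Finset.mem_univ _, fun v hv => ?_⟩
    by_contra hcon
    push Not at hcon
    have hv₀ := hVV₀ hv
    set y := localModel g' σ w with hy'
    have hyz : ∀ k ∈ K, y (σ k v) = z k := fun k hk => by
      rw [hcon _ (Finset.mem_image_of_mem _ hk), hq v hv₀ k hk]
    have hvB : v ∉ B := by simpa [h1] using hV₀good v hv₀ 1 h1F
    -- Since `y` is the image of `w`, the model of `g` returns `w` at each `σ t v`, and `g'` sees
    -- only these points.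
    have hfix : localModel g' σ (localModel g σ y) v = y v :=
      hg' _ _ fun t ht => hleft w _ (hV₀good v hv₀ t ht)
    rw [localModel_localModel (F := (F : Set M)) hg' hg (hBgood v hvB)] at hfix
    apply hz
    calc g' (fun m => g (configShift m z))
        = g' fun m => g (configShift m fun k => y (σ k v)) :=
          hg' _ _ fun t ht => hg _ _ fun s hs => (hyz _ (hmulK s hs t ht)).symm
      _ = y v := hfix
      _ = z 1 := by rw [← hyz 1 h1K, h1]; rfl
  have hup : (Finset.univ.filter fun y : D → A => ∀ v ∈ V, ∃ d ∈ W v, y d ≠ q v d).card *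
      (a ^ n) ^ V.card ≤ (a ^ n - 1) ^ V.card * a ^ Fintype.card D := by
    convert card_avoiding_mul_le W q V hVdisj (n := n) fun v _ => Finset.card_image_le
  have hlt := pow_pred_mul_pow_lt_pow hp hT hTB hVpos
  have hIm : _ ≤ (Finset.univ.filter fun y : D → A => ∀ v ∈ V, ∃ d ∈ W v, y d ≠ q v d).card :=
    Finset.card_le_card havoid
  have hX : 0 < a ^ Fintype.card D := by positivity
  refine absurd hlt (not_lt.2 (Nat.le_of_mul_le_mul_left ?_ hX))
  calc a ^ Fintype.card D * (a ^ n) ^ V.card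
      ≤ ((Finset.univ.image (localModel (A := A) g' σ)).card * a ^ B.card) *
          (a ^ n) ^ V.card := Nat.mul_le_mul_right _ hlow
    _ = ((Finset.univ.image (localModel (A := A) g' σ)).card * (a ^ n) ^ V.card) *
          a ^ B.card := by ring
    _ ≤ ((a ^ n - 1) ^ V.card * a ^ Fintype.card D) * a ^ B.card :=
        Nat.mul_le_mul_right _ ((Nat.mul_le_mul_right _ hIm).trans hup)
    _ = a ^ Fintype.card D * ((a ^ n - 1) ^ V.card * a ^ B.card) := by ring

/-! ### From local rules to cellular automata -/

theorem apply_eq_apply_configShift_one {M A : Type*} [Monoid M] {τ : (M → A) → M → A}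
    (hτ : ∀ (m : M) (x : M → A), τ (configShift m x) = configShift m (τ x)) (x : M → A) (m : M) :
    τ x m = τ (configShift m x) 1 := by
  rw [hτ]
  simp [configShift]

/-- Over a strongly sofic monoid, a one-sided inverse of a cellular automaton with finite alphabet
is two-sided. -/
theorem StronglySofic.comp_eq_of_comp_eq {M A : Type*} [Monoid M] (hM : StronglySofic M)
    [Finite A] [TopologicalSpace A] [DiscreteTopology A] {τ τ' : (M → A) → M → A}
    (hc : Continuous τ) (hs : ∀ (m : M) (x : M → A), τ (configShift m x) = configShift m (τ x))
    (hc' : Continuous τ')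
    (hs' : ∀ (m : M) (x : M → A), τ' (configShift m x) = configShift m (τ' x))
    (h : ∀ x, τ (τ' x) = x) (x : M → A) : τ' (τ x) = x := by
  classical
  obtain ⟨F, hF⟩ := exists_finset_dependsOn_of_continuous ((continuous_apply (1 : M)).comp hc)
  obtain ⟨F', hF'⟩ := exists_finset_dependsOn_of_continuous ((continuous_apply (1 : M)).comp hc')
  have key := hM.localRule_comp_eq (g := fun x => τ x 1) (g' := fun x => τ' x 1)
    (F := insert 1 (F ∪ F')) (by simp)
    (fun x y hxy => hF x y fun m hm => hxy m (by simp [hm]))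
    (fun x y hxy => hF' x y fun m hm => hxy m (by simp [hm]))
    (fun x => by
      simp only [← apply_eq_apply_configShift_one hs' x]
      exact congrFun (h x) 1)
  funext m
  have := key (configShift m x)
  simp only [← apply_eq_apply_configShift_one hs] at this
  rw [apply_eq_apply_configShift_one hs', ← hs]
  simpa [configShift] using this

/-! ### The bicyclic monoid -/

theorem BicyclicMonoid.p_mul_q :
    (PresentedMonoid.of BicyclicRel .p * PresentedMonoid.of BicyclicRel .q : BicyclicMonoid) = 1 :=
  PresentedMonoid.mk_eq_mk_of_rel BicyclicRel.pq

/-- Let `p`, `q` act on `ℕ` as predecessor and successor: as `Nat.pred 0 = 0`, the product `q p`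
sends `0` to `1`. -/
theorem BicyclicMonoid.q_mul_p_ne_one :
    (PresentedMonoid.of BicyclicRel .q * PresentedMonoid.of BicyclicRel .p : BicyclicMonoid) ≠
      1 := by
  intro h
  let f : BicyclicGen → Function.End ℕ := fun
    | .p => Nat.pred
    | .q => Nat.succ
  have hf : ∀ a b, BicyclicRel a b → FreeMonoid.lift f a = FreeMonoid.lift f b := by
    rintro _ _ ⟨⟩
    rw [map_mul, map_one, FreeMonoid.lift_eval_of, FreeMonoid.lift_eval_of]
    rfl
  have := congrArg (PresentedMonoid.lift f hf) h
  rw [map_mul, map_one, PresentedMonoid.lift_of, PresentedMonoid.lift_of] at this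
  exact absurd (congrFun this (0 : ℕ)) (Nat.succ_ne_zero 0)

/-- A directly finite monoid has no bicyclic submonoid. -/
theorem not_nonempty_mulEquiv_bicyclicMonoid {S : Type*} [Monoid S] [IsDedekindFiniteMonoid S]
    (N : Submonoid S) : ¬ Nonempty (N ≃* BicyclicMonoid) := by
  rintro ⟨φ⟩
  have h := congrArg φ.symm BicyclicMonoid.p_mul_q
  rw [map_mul, map_one] at h
  have h' := mul_eq_one_symm (congrArg (Subtype.val : N → S) h)
  apply BicyclicMonoid.q_mul_p_ne_one
  apply φ.symm.injective
  rw [map_mul, map_one]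
  exact Subtype.ext h'

theorem corollary1p2 {M A : Type*} [Monoid M] (hM : StronglySofic M)
    [Finite A] [TopologicalSpace A] [DiscreteTopology A] :
    IsDedekindFiniteMonoid (CA M A) ∧
      ¬ ∃ N : Submonoid (CA M A), Nonempty (N ≃* BicyclicMonoid) := by
  have hfin : IsDedekindFiniteMonoid (CA M A) := by
    refine ⟨fun {τ τ'} h => Subtype.ext (funext fun x => ?_)⟩
    exact hM.comp_eq_of_comp_eq τ.2.1 τ.2.2 τ'.2.1 τ'.2.2
      (fun y => congrFun (congrArg Subtype.val h) y) x
  exact ⟨hfin, fun ⟨N, hN⟩ => not_nonempty_mulEquiv_bicyclicMonoid N hN⟩
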